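/- Let $A$ be a Hermitian $n\times n$ complex matrix with a fixed spectral decomposition $A=U_A\Lambda_\alpha U_A^*$, where $U_A$ is unitary and $\Lambda_\alpha$ is the diagonal matrix with real diagonal entries $\alpha_1,\dots,\alpha_n$ (in any order). For a Hermitian matrix $E$ put $\hat E=U_A^*EU_A$, let $\|\cdot\|$ be the operator norm, let $\circ$ be the Hadamard (entrywise) product, and let $M$ be the matrix with $M_{ij}=1/(\alpha_i-\alpha_j)$ if $\alpha_i\neq\alpha_j$ and $M_{ij}=0$ otherwise. For an eigenvalue $\rho$ of $A$ split the indices into $\{i:\alpha_i=\rho\}$ and $\{i:\alpha_i\ne\rho\}$, write $\hat E=\begin{pmatrix}\hat E_{11}&C\\ C^*&D\end{pmatrix}$ accordingly, let $\Lambda_\tau$ be the diagonal matrix of the $\alpha_i\ne\rho$, and define the Schur complement for $\rho$ as $$B=\hat E_{11}-C(\Lambda_\tau-\rho I+D)^{\dagger}C^*,$$ where $\dagger$ is the Moore–Penrose inverse (the ordinary inverse whenever $\Lambda_\tau-\rho I+D$ is invertible, in particular for all small $E$). Fix $c>0$, and let $\mathcal V_c$ be the set of Hermitian matrices $E$ such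 that, for every eigenvalue $\rho$ of $A$, the Schur complement $B$ for $\rho$ is diagonal and its diagonal entries $\beta_i=B_{ii}$ satisfy $|\beta_i-\beta_j|\ge c\|E\|$ for all $i\ne j$ with $\alpha_i=\alpha_j=\rho$. Then there are a map $U$ from $\mathcal V_c$ to the unitary $n\times n$ matrices and a constant $K$ such that, for every $E\in\mathcal V_c$, each column of $U(E)$ is a (normalized) eigenvector of $A+E$, and $$\big\|U(E)-U_A(I-M\circ\hat E)\big\|\le K\|\hat E\|^2 .$$ -/

import Mathlib

open scoped Matrix Matrix.Norms.L2Operator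

/-- `X` is the Moore-Penrose inverse of `N`: the four Penrose equations. They have exactly one
solution, and it is `N⁻¹` when `N` is invertible (see the two lemmas below). -/
def IsMoorePenrose {ι : Type*} [Fintype ι] (N X : Matrix ι ι ℂ) : Prop :=
  N * X * N = N ∧ X * N * X = X ∧ (N * X).IsHermitian ∧ (X * N).IsHermitian

theorem IsMoorePenrose.unique {ι : Type*} [Fintype ι] {N X Y : Matrix ι ι ℂ}
    (hX : IsMoorePenrose N X) (hY : IsMoorePenrose N Y) : X = Y := by
  obtain ⟨x1, x2, x3, x4⟩ := hX
  obtain ⟨y1, y2, y3, y4⟩ := hY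
  have h1 : N * X = N * Y := by
    have e : N * X = (N * Y) * (N * X) := by rw [← mul_assoc, y1]
    have e2 : (N * X)ᴴ = ((N * Y) * (N * X))ᴴ := congrArg _ e
    rw [x3.eq, Matrix.conjTranspose_mul (N * Y), x3.eq, y3.eq] at e2
    rw [e2, ← mul_assoc, x1]
  have h2 : X * N = Y * N := by
    have e : X * N = (X * N) * (Y * N) := by rw [mul_assoc, ← mul_assoc N, y1]
    have e2 : (X * N)ᴴ = ((X * N) * (Y * N))ᴴ := congrArg _ e
    rw [x4.eq, Matrix.conjTranspose_mul (X * N), x4.eq, y4.eq] at e2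
    rw [e2, mul_assoc, ← mul_assoc N, x1]
  rw [← x2, h2, mul_assoc, h1, ← mul_assoc, y2]

theorem isMoorePenrose_inv {ι : Type*} [Fintype ι] [DecidableEq ι] {N : Matrix ι ι ℂ}
    (hN : IsUnit N.det) : IsMoorePenrose N N⁻¹ := by
  simp [IsMoorePenrose, Matrix.mul_nonsing_inv N hN, Matrix.nonsing_inv_mul N hN]

/-- The diagonal matrix `Λ_α`, with real entries `α 0, …, α (n-1)`. -/
noncomputable def Lam {n : ℕ} (α : Fin n → ℝ) : Matrix (Fin n) (Fin n) ℂ :=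
  Matrix.diagonal fun i => (α i : ℂ)

/-- `Ê = U_A^* E U_A`: the perturbation in the basis of the columns of `U_A`. -/
noncomputable def hat {n : ℕ} (UA E : Matrix (Fin n) (Fin n) ℂ) : Matrix (Fin n) (Fin n) ℂ :=
  UAᴴ * E * UA

/-- `M_{ij} = 1 / (α_i - α_j)` if `α_i ≠ α_j`, and `0` otherwise. -/
noncomputable def matM {n : ℕ} (α : Fin n → ℝ) : Matrix (Fin n) (Fin n) ℂ :=
  Matrix.of fun i j => if α i = α j then 0 else 1 / ((α i : ℂ) - (α j : ℂ))

/-- `U_ap(E) = U_A (I - M ∘ Ê)`, with the Hadamard product. -/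
noncomputable def Uap {n : ℕ} (α : Fin n → ℝ) (UA E : Matrix (Fin n) (Fin n) ℂ) :
    Matrix (Fin n) (Fin n) ℂ :=
  UA * (1 - Matrix.hadamard (matM α) (hat UA E))

/-- `B` is the Schur complement for `ρ` of the matrix `F` (which will be `Ê`), that is
`B = F₁₁ - C (Λ_τ - ρ I + D)^† C^*`. The first block of indices is `{i | α i = ρ}`, the second one
is `{i | α i ≠ ρ}`; `C` and `D` are the upper right and the lower right block of `F`, and
`Λ_τ - ρ I` is the lower right block of `Λ_α - ρ I`. -/
def IsSchurComplement {n : ℕ} (α : Fin n → ℝ) (F : Matrix (Fin n) (Fin n) ℂ) (ρ : ℝ)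
    (B : Matrix {i // α i = ρ} {i // α i = ρ} ℂ) : Prop :=
  ∃ X : Matrix {i // α i ≠ ρ} {i // α i ≠ ρ} ℂ,
    IsMoorePenrose
      ((Lam α - (ρ : ℂ) • (1 : Matrix (Fin n) (Fin n) ℂ) + F).toBlock
        (fun i => α i ≠ ρ) (fun i => α i ≠ ρ)) X ∧
    B = F.toBlock (fun i => α i = ρ) (fun i => α i = ρ)
      - F.toBlock (fun i => α i = ρ) (fun i => α i ≠ ρ) * X
        * (F.toBlock (fun i => α i = ρ) (fun i => α i ≠ ρ))ᴴ

/-- The set `V_c` of Hermitian perturbations `E` of `A = U_A Λ_α U_A^*` such that, for every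
eigenvalue `ρ` of `A`, the Schur complement `B` is diagonal, with diagonal entries (eigenvalues)
`β_i = B_{ii}` that satisfy `|β_i - β_j| ≥ c ‖E‖` for `i ≠ j`. -/
def VSet {n : ℕ} (α : Fin n → ℝ) (UA : Matrix (Fin n) (Fin n) ℂ) (c : ℝ) :
    Set (Matrix (Fin n) (Fin n) ℂ) :=
  {E | E.IsHermitian ∧ ∀ ρ ∈ Set.range α, ∃ B : Matrix {i // α i = ρ} {i // α i = ρ} ℂ,
    IsSchurComplement α (hat UA E) ρ B ∧ B.IsDiag ∧
      ∀ i j, i ≠ j → c * ‖E‖ ≤ ‖B i i - B j j‖}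

/-! Write `F` for the perturbation in the eigenbasis of `A`, and let ε = ‖F‖. For small ε > 0 the
block of Λ - α_i + F off the eigenspace of α_i is invertible, call it N. The column T_i = (e_i,
-N⁻¹C^*e_i) then satisfies (Λ + F - α_i) T_i = β_i e_i, because the Schur complement is diagonal.
Two facts follow: T = I - M∘F + O(ε²), and T_i is an approximate eigenvector for α_i + β_i with
residual -β_i times its part outside the block, which is O(ε²).

Let V be a unitary eigenbasis of Λ + F with eigenvalues ξ. Pairing the residual with V_k
(`overlap_eq`) gives (ξ_k - α_i - β_i)⟨V_k, T_i⟩ = -β_i⟨V_k, T_i outside the block⟩. A determinant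
argument orders V so that ξ_i = α_i + β_i + O(ε²) (`exists_matched_diagonalization`). For k ≠ i in
different blocks the factor on the left is bounded below, so the overlap is O(ε²). Inside a block
the factor is only of order cε, but there V_k itself is O(ε) outside the block, so the right side is
O(ε³) and the overlap is again O(ε²) (`norm_overlap_le`).

Unitarity makes the diagonal overlaps 1 + O(ε²) in modulus. Correcting the phases makes V^*T = I +
O(ε²), hence V = T + O(ε²). For ‖F‖ bounded away from 0, any eigenbasis works once the constant is
large enough. -/

section EntryBounds

/-! ### Entrywise norm estimates, determinants, spectral gap -/

variable {n : ℕ}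

theorem l2_opNorm_single_le (i j : Fin n) (a : ℂ) :
    ‖(Matrix.single i j a : Matrix (Fin n) (Fin n) ℂ)‖ ≤ ‖a‖ := by
  have h : (Matrix.single i j a : Matrix (Fin n) (Fin n) ℂ)ᴴ * Matrix.single i j a
      = Matrix.diagonal (Pi.single j (star a * a)) := by
    rw [Matrix.conjTranspose_single, Matrix.single_mul_single_same, Matrix.diagonal_single]
  have h2 := Matrix.l2_opNorm_conjTranspose_mul_self
    (Matrix.single i j a : Matrix (Fin n) (Fin n) ℂ)
  rw [h, Matrix.l2_opNorm_diagonal, Pi.norm_single, norm_mul, norm_star] at h2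
  exact le_of_eq (mul_self_inj_of_nonneg (norm_nonneg _) (norm_nonneg _) |>.1 h2.symm)

theorem l2_opNorm_le_of_entry_le {X : Matrix (Fin n) (Fin n) ℂ} {r : ℝ}
    (h : ∀ i j, ‖X i j‖ ≤ r) : ‖X‖ ≤ n * (n * r) := by
  rw [Matrix.matrix_eq_sum_single X]
  refine (norm_sum_le _ _).trans ?_
  have : ∀ i : Fin n, ‖∑ j, Matrix.single i j (X i j)‖ ≤ n * r := fun i => by
    refine (norm_sum_le _ _).trans ?_
    refine (Finset.sum_le_sum fun j _ => (l2_opNorm_single_le i j _).trans (h i j)).trans ?_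
    simp
  refine (Finset.sum_le_sum fun i _ => this i).trans ?_
  simp

theorem entry_le_l2_opNorm (X : Matrix (Fin n) (Fin n) ℂ) (i j : Fin n) : ‖X i j‖ ≤ ‖X‖ := by
  have h := X.l2_opNorm_mulVec (WithLp.toLp 2 (Pi.single j 1))
  have h2 := PiLp.norm_apply_le ((EuclideanSpace.equiv (Fin n) ℂ).symm (X *ᵥ Pi.single j 1)) i
  simp at h h2
  exact h2.trans h

theorem norm_sum_mul_le {x y : Fin n → ℂ} {a b : ℝ} (hx : ∀ i, ‖x i‖ ≤ a)
    (hy : ∀ i, ‖y i‖ ≤ b) : ‖∑ i, x i * y i‖ ≤ n * (a * b) := by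
  refine (norm_sum_le _ _).trans ?_
  have : ∀ i, ‖x i * y i‖ ≤ a * b := fun i => by
    rw [norm_mul]
    exact mul_le_mul (hx i) (hy i) (norm_nonneg _) ((norm_nonneg _).trans (hx i))
  refine (Finset.sum_le_sum fun i _ => this i).trans ?_
  simp

theorem exists_half_le_norm_det (n : ℕ) : ∃ δ > 0, ∀ T : Matrix (Fin n) (Fin n) ℂ,
    ‖T - 1‖ < δ → 1 / 2 ≤ ‖T.det‖ := by
  have hc : Continuous fun T : Matrix (Fin n) (Fin n) ℂ => T.det := continuous_id.matrix_det
  obtain ⟨δ, hδ, h⟩ := Metric.continuous_iff.1 hc 1 (1 / 2) (by norm_num)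
  refine ⟨δ, hδ, fun T hT => ?_⟩
  have h1 := h T (by rwa [dist_eq_norm])
  rw [dist_eq_norm, Matrix.det_one] at h1
  have h2 := norm_sub_norm_le (1 : ℂ) (1 - T.det)
  rw [norm_sub_rev] at h1
  simp at h2
  linarith

/-- If every permutation met an entry below η, each of the n! terms of the Leibniz expansion would
be smaller than η (n+1)^n, and their sum smaller than 1/2. Used to match eigenvectors with
approximate ones. -/
theorem exists_perm_norm_entry_ge (n : ℕ) : ∃ η > 0, ∀ W : Matrix (Fin n) (Fin n) ℂ,
    (∀ i j, ‖W i j‖ ≤ n) → 1 / 2 ≤ ‖W.det‖ → ∃ σ : Equiv.Perm (Fin n), ∀ i, η ≤ ‖W (σ i) i‖ := by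
  refine ⟨1 / (2 * n.factorial * (n + 1) ^ n), by positivity, fun W hW hdet => ?_⟩
  by_contra! hcon
  have hn : (0 : ℝ) < n.factorial := by positivity
  have key : ∀ σ : Equiv.Perm (Fin n), ‖∏ i, W (σ i) i‖ < 1 / (2 * n.factorial) := by
    intro σ
    obtain ⟨i, hi⟩ := hcon σ
    rw [norm_prod, ← Finset.mul_prod_erase _ _ (Finset.mem_univ i)]
    -- The base n + 1 is at least 1, so the exponent can be raised to n, even when n = 0.
    have h1 : ∏ j ∈ Finset.univ.erase i, ‖W (σ j) j‖ ≤ ((n : ℝ) + 1) ^ n := by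
      refine (Finset.prod_le_prod (fun _ _ => norm_nonneg _)
        (fun j _ => (hW (σ j) j).trans (by linarith : (n : ℝ) ≤ n + 1))).trans ?_
      rw [Finset.prod_const]
      refine pow_le_pow_right₀ (by linarith [(Nat.cast_nonneg n : (0 : ℝ) ≤ n)]) ?_
      exact (Finset.card_le_univ _).trans (by simp)
    calc _ ≤ ‖W (σ i) i‖ * ((n : ℝ) + 1) ^ n := mul_le_mul_of_nonneg_left h1 (norm_nonneg _)
      _ < 1 / (2 * n.factorial * (n + 1) ^ n) * ((n : ℝ) + 1) ^ n :=
        mul_lt_mul_of_pos_right hi (by positivity)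
      _ = _ := by field_simp
  have : ‖W.det‖ < 1 / 2 := by
    rw [Matrix.det_apply]
    refine (norm_sum_le _ _).trans_lt ?_
    have h3 : ∀ σ : Equiv.Perm (Fin n),
        ‖Equiv.Perm.sign σ • ∏ i, W (σ i) i‖ < 1 / (2 * n.factorial) := fun σ => by
      rcases Int.units_eq_one_or (Equiv.Perm.sign σ) with h | h <;> simpa [h] using key σ
    refine (Finset.sum_lt_sum_of_nonempty Finset.univ_nonempty fun σ _ => h3 σ).trans_le ?_
    rw [Finset.sum_const, Finset.card_univ, Fintype.card_perm, Fintype.card_fin, nsmul_eq_mul]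
    apply le_of_eq
    field_simp
  linarith

theorem exists_gap (α : Fin n → ℝ) :
    ∃ g : ℝ, 0 < g ∧ g ≤ 1 ∧ ∀ i j, α i ≠ α j → g ≤ |α i - α j| := by
  classical
  have : ∀ s : Finset (Fin n × Fin n), ∃ g : ℝ, 0 < g ∧ g ≤ 1 ∧
      ∀ p ∈ s, α p.1 ≠ α p.2 → g ≤ |α p.1 - α p.2| := by
    intro s
    induction s using Finset.induction_on with
    | empty => exact ⟨1, one_pos, le_rfl, by simp⟩
    | insert p s _ ih =>
      obtain ⟨g, h0, h1, h⟩ := ih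
      by_cases hp : α p.1 = α p.2
      · refine ⟨g, h0, h1, fun q hq hne => ?_⟩
        rcases Finset.mem_insert.1 hq with rfl | hq
        · exact absurd hp hne
        · exact h q hq hne
      · refine ⟨min g |α p.1 - α p.2|, lt_min h0 (abs_pos.2 (sub_ne_zero.2 hp)),
          (min_le_left _ _).trans h1, fun q hq hne => ?_⟩
        rcases Finset.mem_insert.1 hq with rfl | hq
        · exact min_le_right _ _
        · exact (min_le_left _ _).trans (h q hq hne)
  obtain ⟨g, h0, h1, h⟩ := this Finset.univ
  exact ⟨g, h0, h1, fun i j => h (i, j) (Finset.mem_univ _)⟩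

end EntryBounds

/-! ### Block solutions attached to the Schur complements -/

section SchurColumn

variable {n : ℕ} {α : Fin n → ℝ} {F : Matrix (Fin n) (Fin n) ℂ}

/-- Strict diagonal dominance: diagonal entries are at least g - ε in modulus, while the rest of a
row sums to at most nε. -/
theorem isUnit_det_toBlock_ne {g ε : ℝ} (hg : ∀ i j, α i ≠ α j → g ≤ |α i - α j|)
    (hF : ∀ i j, ‖F i j‖ ≤ ε) (hε : (n + 1) * ε < g) (i : Fin n) :
    IsUnit ((Lam α - (α i : ℂ) • (1 : Matrix (Fin n) (Fin n) ℂ) + F).toBlock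
      (fun j => α j ≠ α i) (fun j => α j ≠ α i)).det := by
  rw [isUnit_iff_ne_zero]
  have h0 : 0 ≤ ε := (norm_nonneg _).trans (hF i i)
  refine det_ne_zero_of_sum_row_lt_diag fun k => ?_
  have h1 : ∑ j ∈ Finset.univ.erase k, ‖(Lam α - (α i : ℂ) • (1 : Matrix (Fin n) (Fin n) ℂ)
      + F).toBlock (fun j => α j ≠ α i) (fun j => α j ≠ α i) k j‖ ≤ n * ε := by
    have : ∀ j ∈ Finset.univ.erase k, ‖(Lam α - (α i : ℂ) • (1 : Matrix (Fin n) (Fin n) ℂ)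
      + F).toBlock (fun j => α j ≠ α i) (fun j => α j ≠ α i) k j‖ ≤ ε := by
      intro j hj
      have hkj : (k : Fin n) ≠ j := fun h => (Finset.ne_of_mem_erase hj) (Subtype.ext h.symm)
      simpa [Lam, Matrix.toBlock_apply, Matrix.diagonal_apply_ne _ hkj, Matrix.one_apply_ne hkj]
        using hF k j
    refine (Finset.sum_le_card_nsmul _ _ _ this).trans ?_
    rw [nsmul_eq_mul]
    refine mul_le_mul_of_nonneg_right ?_ h0
    have h2 : (Finset.univ.erase k).card ≤ n :=
      (Finset.card_le_univ _).trans ((Fintype.card_subtype_le _).trans (by simp))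
    exact_mod_cast h2
  have h2 : g - ε ≤ ‖(Lam α - (α i : ℂ) • (1 : Matrix (Fin n) (Fin n) ℂ)
      + F).toBlock (fun j => α j ≠ α i) (fun j => α j ≠ α i) k k‖ := by
    have h3 : (Lam α - (α i : ℂ) • (1 : Matrix (Fin n) (Fin n) ℂ)
      + F).toBlock (fun j => α j ≠ α i) (fun j => α j ≠ α i) k k
        = ((α k - α i : ℝ) : ℂ) - - F k k := by
      simp [Lam, Matrix.toBlock_apply]
    rw [h3]
    refine le_trans ?_ (norm_sub_norm_le _ _)
    rw [Complex.norm_real, Real.norm_eq_abs, norm_neg]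
    linarith [hg k i k.2, hF k k]
  linarith

/-- Block elimination: v = (e_i, -N⁻¹C^*e_i) annihilates the second block row, and the first block
row becomes B e_i, which is B_ii e_i since B is diagonal. -/
theorem exists_schur_column (hF : F.IsHermitian) {ρ : ℝ}
    {B : Matrix {i // α i = ρ} {i // α i = ρ} ℂ} (hB : IsSchurComplement α F ρ B)
    (hBd : B.IsDiag)
    (hdet : IsUnit ((Lam α - (ρ : ℂ) • (1 : Matrix (Fin n) (Fin n) ℂ) + F).toBlock
      (fun j => α j ≠ ρ) (fun j => α j ≠ ρ)).det) (i : {i // α i = ρ}) :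
    ∃ v : Fin n → ℂ, (∀ j, α j = ρ → v j = if j = i then 1 else 0) ∧
      ∀ j, ((α j : ℂ) - ρ) * v j + (F *ᵥ v) j = if j = i then B i i else 0 := by
  classical
  obtain ⟨X, hX, hBX⟩ := hB
  set N := (Lam α - (ρ : ℂ) • (1 : Matrix (Fin n) (Fin n) ℂ) + F).toBlock
      (fun j => α j ≠ ρ) (fun j => α j ≠ ρ) with hN
  set C := F.toBlock (fun i => α i = ρ) (fun i => α i ≠ ρ) with hC
  have hNX : N * X = 1 := by
    rw [hX.unique (isMoorePenrose_inv hdet), Matrix.mul_nonsing_inv N hdet]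
  let v : Fin n → ℂ := fun j =>
    if h : α j = ρ then (if j = i then 1 else 0) else - (X * Cᴴ) ⟨j, h⟩ i
  have hv1 : ∀ j : {j // α j = ρ}, v j = if j = i then 1 else 0 := fun j => by
    simp [v, j.2, Subtype.ext_iff]
  have hv2 : ∀ j : {j // α j ≠ ρ}, v j = - (X * Cᴴ) j i := fun j => by
    simp [v, j.2]
  have hsum : ∀ j, (F *ᵥ v) j = F j i - ∑ k : {k // α k ≠ ρ}, F j k * (X * Cᴴ) k i := by
    intro j
    rw [Matrix.mulVec, dotProduct, ← Fintype.sum_subtype_add_sum_subtype (fun k => α k = ρ)]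
    simp only [hv1]
    have : ∑ k : {k // ¬ α k = ρ}, F j k * v k
        = - ∑ k : {k // α k ≠ ρ}, F j k * (X * Cᴴ) k i := by
      rw [← Finset.sum_neg_distrib]
      exact Finset.sum_congr rfl fun k _ => by rw [hv2 k, mul_neg]
    rw [this]
    simp [sub_eq_add_neg]
  refine ⟨v, fun j hj => by rw [hv1 ⟨j, hj⟩]; simp [Subtype.ext_iff], fun j => ?_⟩
  by_cases hj : α j = ρ
  · have hBj : (F *ᵥ v) j = B ⟨j, hj⟩ i := by
      rw [hsum, hBX, Matrix.mul_assoc, Matrix.sub_apply, Matrix.mul_apply]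
      simp [hC, Matrix.toBlock_apply]
    rw [hBj, hj, sub_self, zero_mul, zero_add]
    split_ifs with h
    · subst h; rfl
    · exact hBd fun h' => h (by rw [← h'])
  · have hji : j ≠ i := fun h => hj (by rw [h]; exact i.2)
    rw [if_neg hji, hsum, hv2 ⟨j, hj⟩]
    have h1 : (N * (X * Cᴴ)) ⟨j, hj⟩ i = F j i := by
      rw [← Matrix.mul_assoc, hNX, Matrix.one_mul]
      simp only [hC, Matrix.conjTranspose_apply, Matrix.toBlock_apply]
      exact hF.apply j i
    have h2 : (N * (X * Cᴴ)) ⟨j, hj⟩ i = ((α j : ℂ) - ρ) * (X * Cᴴ) ⟨j, hj⟩ i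
        + ∑ k : {k // α k ≠ ρ}, F j k * (X * Cᴴ) k i := by
      rw [Matrix.mul_apply]
      have h3 : ∀ k : {k // α k ≠ ρ}, N ⟨j, hj⟩ k * (X * Cᴴ) k i
          = (if k = ⟨j, hj⟩ then ((α j : ℂ) - ρ) * (X * Cᴴ) k i else 0)
            + F j k * (X * Cᴴ) k i := by
        intro k
        have h4 : N ⟨j, hj⟩ k = (if k = ⟨j, hj⟩ then ((α j : ℂ) - ρ) else 0) + F j k := by
          rw [hN, Matrix.toBlock_apply]
          by_cases hk : k = ⟨j, hj⟩
          · subst hk; simp [Lam]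
          · have : j ≠ k := fun h => hk (Subtype.ext h.symm)
            simp [Lam, Matrix.diagonal_apply_ne _ this, Matrix.one_apply_ne this, hk]
        rw [h4, add_mul, ite_mul, zero_mul]
      simp only [h3, Finset.sum_add_distrib]
      simp
    rw [h2] at h1
    linear_combination -h1

/-- Bounds for a solution of the block system `(Λ_α - ρ + F) v = b e_i` that is normalized on the
index block of `ρ`. -/
theorem schur_column_bounds {g ε ρ : ℝ} (hg0 : 0 < g) (hg : ∀ j, α j ≠ ρ → g ≤ |α j - ρ|)
    (hF : ∀ i j, ‖F i j‖ ≤ ε) (hε : 2 * n * ε ≤ g) {i : Fin n} (hi : α i = ρ)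
    {v : Fin n → ℂ} {b : ℂ} (hv1 : ∀ j, α j = ρ → v j = if j = i then 1 else 0)
    (hv2 : ∀ j, ((α j : ℂ) - ρ) * v j + (F *ᵥ v) j = if j = i then b else 0) :
    ‖b‖ ≤ 2 * ε ∧ (∀ j, α j ≠ ρ → ‖v j‖ ≤ 2 * ε / g) ∧
      ∀ j, α j ≠ ρ → ‖v j + F j i / (α j - ρ)‖ ≤ 2 * n * ε ^ 2 / g ^ 2 := by
  have hε0 : 0 ≤ ε := (norm_nonneg _).trans (hF i i)
  set S := ∑ j, ‖v j‖ with hS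
  have hS0 : 0 ≤ S := Finset.sum_nonneg fun _ _ => norm_nonneg _
  have hvi : v i = 1 := by simp [hv1 i hi]
  have hFv : ∀ j, ‖(F *ᵥ v) j‖ ≤ ε * S := fun j => by
    rw [Matrix.mulVec, dotProduct, hS, Finset.mul_sum]
    refine (norm_sum_le _ _).trans (Finset.sum_le_sum fun k _ => ?_)
    rw [norm_mul]
    exact mul_le_mul_of_nonneg_right (hF j k) (norm_nonneg _)
  have hnorm : ∀ j, ‖(α j : ℂ) - ρ‖ = |α j - ρ| := fun j => by
    rw [← Complex.ofReal_sub, Complex.norm_real, Real.norm_eq_abs]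
  have hoff : ∀ j, α j ≠ ρ → g * ‖v j‖ ≤ ε * S := fun j hj => by
    have hji : j ≠ i := fun h => hj (h ▸ hi)
    have h := hv2 j
    rw [if_neg hji] at h
    have h1 : ‖((α j : ℂ) - ρ) * v j‖ = ‖(F *ᵥ v) j‖ := by
      rw [eq_neg_of_add_eq_zero_left h, norm_neg]
    rw [norm_mul, hnorm] at h1
    calc g * ‖v j‖ ≤ |α j - ρ| * ‖v j‖ := mul_le_mul_of_nonneg_right (hg j hj) (norm_nonneg _)
      _ ≤ ε * S := h1.le.trans (hFv j)
  -- Self-bounding estimate for the ℓ¹ norm S of v: the entries other than v_i = 1 are at most εS/g,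
  -- and 2nε ≤ g then forces S ≤ 2.
  have hS1 : g * (S - 1) ≤ n * (ε * S) := by
    have h : ∀ j, g * (‖v j‖ - if j = i then 1 else 0) ≤ ε * S := fun j => by
      by_cases hj : α j = ρ
      · rw [hv1 j hj]
        have : 0 ≤ ε * S := mul_nonneg hε0 hS0
        split_ifs <;> simpa using this
      · have hji : j ≠ i := fun h => hj (h ▸ hi)
        simpa [hji] using hoff j hj
    have h2 := Finset.sum_le_sum fun j (_ : j ∈ Finset.univ) => h j
    rw [← Finset.mul_sum, Finset.sum_sub_distrib] at h2
    simpa using h2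
  have hS2 : S ≤ 2 := by
    have : (2 * n * ε) * S ≤ g * S := mul_le_mul_of_nonneg_right hε hS0
    nlinarith
  have hFv2 : ∀ j, ‖(F *ᵥ v) j‖ ≤ 2 * ε := fun j => by nlinarith [hFv j]
  refine ⟨?_, fun j hj => ?_, fun j hj => ?_⟩
  · have h := hv2 i
    rw [hi, sub_self, zero_mul, zero_add, if_pos rfl] at h
    exact h ▸ hFv2 i
  · rw [le_div_iff₀ hg0]
    nlinarith [hoff j hj]
  · have hji : j ≠ i := fun h => hj (h ▸ hi)
    have hne : (α j : ℂ) - ρ ≠ 0 := sub_ne_zero.2 (by exact_mod_cast hj)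
    have h := hv2 j
    rw [if_neg hji, Matrix.mulVec, dotProduct, ← Finset.add_sum_erase _ _ (Finset.mem_univ i),
      hvi, mul_one] at h
    -- The term k = i of (Fv)_j is exactly the first-order term; the other terms carry weight S - 1
    -- = O(ε), which supplies the second factor ε.
    have h1 : v j + F j i / (α j - ρ)
        = - (∑ k ∈ Finset.univ.erase i, F j k * v k) / (α j - ρ) := by
      field_simp
      linear_combination h
    have h2 : ‖∑ k ∈ Finset.univ.erase i, F j k * v k‖ ≤ ε * (S - 1) := by
      have h3 : S - 1 = ∑ k ∈ Finset.univ.erase i, ‖v k‖ := by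
        rw [hS, ← Finset.add_sum_erase _ _ (Finset.mem_univ i), hvi]; simp
      rw [h3, Finset.mul_sum]
      refine (norm_sum_le _ _).trans (Finset.sum_le_sum fun k _ => ?_)
      rw [norm_mul]
      exact mul_le_mul_of_nonneg_right (hF j k) (norm_nonneg _)
    have h4 : S - 1 ≤ 2 * n * ε / g := by
      rw [le_div_iff₀ hg0]
      have : (n : ℝ) * (ε * S) ≤ n * (ε * 2) := by gcongr
      linarith
    rw [h1, norm_div, norm_neg, hnorm]
    calc _ ≤ ε * (2 * n * ε / g) / g :=
          div_le_div₀ (by positivity) (h2.trans (mul_le_mul_of_nonneg_left h4 hε0)) hg0 (hg j hj)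
      _ = _ := by ring

end SchurColumn

/-! ### Exact eigenbases and their overlaps with the block solutions -/

section Eigenbasis

variable {n : ℕ} {α : Fin n → ℝ} {F V T : Matrix (Fin n) (Fin n) ℂ} {ξ : Fin n → ℝ} {β : Fin n → ℂ}

theorem isHermitian_Lam (α : Fin n → ℝ) : (Lam α).IsHermitian := by
  rw [Lam, Matrix.isHermitian_diagonal_iff]
  intro i
  simp [IsSelfAdjoint]

theorem exists_unitary_diagonalization {H : Matrix (Fin n) (Fin n) ℂ} (hH : H.IsHermitian) :
    ∃ V ∈ Matrix.unitaryGroup (Fin n) ℂ, ∃ ξ : Fin n → ℝ,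
      H * V = V * Matrix.diagonal fun i => (ξ i : ℂ) := by
  refine ⟨hH.eigenvectorUnitary, hH.eigenvectorUnitary.2, hH.eigenvalues, ?_⟩
  ext i j
  have h := congrFun (hH.mulVec_eigenvectorBasis j) i
  rw [Matrix.mul_diagonal, Matrix.mul_apply]
  simpa [Matrix.mulVec, dotProduct, mul_comm] using h

theorem submatrix_perm_mem_unitaryGroup (hV : V ∈ Matrix.unitaryGroup (Fin n) ℂ)
    (σ : Equiv.Perm (Fin n)) : V.submatrix id σ ∈ Matrix.unitaryGroup (Fin n) ℂ := by
  rw [Matrix.mem_unitaryGroup_iff', Matrix.star_eq_conjTranspose, Matrix.conjTranspose_submatrix,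
    ← Matrix.submatrix_mul _ _ _ _ _ Function.bijective_id, ← Matrix.star_eq_conjTranspose,
    Matrix.mem_unitaryGroup_iff'.1 hV, Matrix.submatrix_one_equiv]

theorem diagonal_mem_unitaryGroup {p : Fin n → ℂ} (hp : ∀ i, ‖p i‖ = 1) :
    Matrix.diagonal p ∈ Matrix.unitaryGroup (Fin n) ℂ := by
  rw [Matrix.mem_unitaryGroup_iff', Matrix.star_eq_conjTranspose, Matrix.diagonal_conjTranspose,
    Matrix.diagonal_mul_diagonal, ← Matrix.diagonal_one]
  congr 1
  funext i
  have := Complex.conj_mul' (p i)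
  simpa [hp i] using this

theorem eigenvector_entry (hVξ : (Lam α + F) * V = V * Matrix.diagonal fun i => (ξ i : ℂ))
    (j k : Fin n) : ((α j : ℂ) - ξ k) * V j k = - (F * V) j k := by
  have h := congrFun (congrFun hVξ j) k
  rw [Matrix.mul_diagonal, Matrix.add_mul, Matrix.add_apply, Lam, Matrix.diagonal_mul] at h
  linear_combination h

/-- The overlap of an eigenvector with an approximate eigenvector is controlled by the residual. -/
theorem overlap_eq (hF : F.IsHermitian)
    (hVξ : (Lam α + F) * V = V * Matrix.diagonal fun i => (ξ i : ℂ))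
    (hT1 : ∀ i j, α j = α i → T j i = if j = i then 1 else 0)
    (hT2 : ∀ i j, ((α j : ℂ) - α i) * T j i + (F * T) j i = if j = i then β i else 0)
    (k i : Fin n) : ((ξ k : ℂ) - (α i + β i)) * (Vᴴ * T) k i
      = - β i * ∑ j, Vᴴ k j * (if α j = α i then 0 else T j i) := by
  have hV' : Vᴴ * (Lam α + F) = (Matrix.diagonal fun i => (ξ i : ℂ)) * Vᴴ := by
    have h := congrArg Matrix.conjTranspose hVξ
    rw [Matrix.conjTranspose_mul, Matrix.conjTranspose_mul, ((isHermitian_Lam α).add hF).eq,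
      Matrix.diagonal_conjTranspose] at h
    rw [h]
    congr 2
    funext i
    simp
  have h1 : (Vᴴ * ((Lam α + F) * T)) k i = ξ k * (Vᴴ * T) k i := by
    rw [← Matrix.mul_assoc, hV', Matrix.mul_assoc, Matrix.diagonal_mul]
  have h2 : ∀ j, ((Lam α + F) * T) j i
      = (α i + β i) * T j i - β i * (if α j = α i then 0 else T j i) := by
    intro j
    rw [Matrix.add_mul, Matrix.add_apply, Lam, Matrix.diagonal_mul]
    have h := hT2 i j
    by_cases hj : α j = α i
    · have h3 := hT1 i j hj
      rw [if_pos hj]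
      split_ifs at h h3 with hji <;> rw [h3] at h ⊢ <;> linear_combination h
    · have hji : j ≠ i := fun h => hj (h ▸ rfl)
      rw [if_neg hj]
      rw [if_neg hji] at h
      linear_combination h
  rw [Matrix.mul_apply] at h1
  simp only [h2] at h1
  have h3 : ∑ j, Vᴴ k j * ((α i + β i) * T j i - β i * (if α j = α i then 0 else T j i))
      = (α i + β i) * (Vᴴ * T) k i - β i * ∑ j, Vᴴ k j * (if α j = α i then 0 else T j i) := by
    rw [Matrix.mul_apply, Finset.mul_sum, Finset.mul_sum, ← Finset.sum_sub_distrib]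
    exact Finset.sum_congr rfl fun j _ => by ring
  rw [h3] at h1
  linear_combination -h1

/-- Columns of `T` and of `Vᴴ * T` have the same Euclidean norm, so the squared diagonal overlap
differs from 1 only by sums of squares of off-diagonal entries. -/
theorem abs_norm_overlap_sub_one_le (hV : V ∈ Matrix.unitaryGroup (Fin n) ℂ) {a b : ℝ}
    {i : Fin n} (hTi : T i i = 1) (hT : ∀ j, j ≠ i → ‖T j i‖ ≤ a)
    (hW : ∀ k, k ≠ i → ‖(Vᴴ * T) k i‖ ≤ b) : |‖(Vᴴ * T) i i‖ - 1| ≤ n * (a ^ 2 + b ^ 2) := by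
  have hsq : ∀ X : Matrix (Fin n) (Fin n) ℂ, (Xᴴ * X) i i = ((∑ j, ‖X j i‖ ^ 2 : ℝ) : ℂ) := by
    intro X
    rw [Matrix.mul_apply, Complex.ofReal_sum]
    refine Finset.sum_congr rfl fun j _ => ?_
    rw [Matrix.conjTranspose_apply, ← starRingEnd_apply, Complex.conj_mul', Complex.ofReal_pow]
  have hWT : (Vᴴ * T)ᴴ * (Vᴴ * T) = Tᴴ * T := by
    rw [Matrix.conjTranspose_mul, Matrix.conjTranspose_conjTranspose, Matrix.mul_assoc,
      ← Matrix.mul_assoc V, ← Matrix.star_eq_conjTranspose V, Matrix.mem_unitaryGroup_iff.1 hV,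
      Matrix.one_mul]
  have h1 : ∑ j, ‖(Vᴴ * T) j i‖ ^ 2 = ∑ j, ‖T j i‖ ^ 2 := by
    have := hsq (Vᴴ * T)
    rw [hWT, hsq T] at this
    exact_mod_cast this.symm
  have hbd : ∀ (x : Fin n → ℝ) (r : ℝ), (∀ j, j ≠ i → |x j| ≤ r) →
      0 ≤ ∑ j ∈ Finset.univ.erase i, x j ^ 2 ∧
        ∑ j ∈ Finset.univ.erase i, x j ^ 2 ≤ n * r ^ 2 := by
    intro x r hx
    refine ⟨Finset.sum_nonneg fun _ _ => sq_nonneg _, ?_⟩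
    refine (Finset.sum_le_card_nsmul _ _ (r ^ 2) fun j hj => ?_).trans ?_
    · exact sq_le_sq.2 ((hx j (Finset.ne_of_mem_erase hj)).trans (le_abs_self r))
    · rw [nsmul_eq_mul]
      refine mul_le_mul_of_nonneg_right ?_ (sq_nonneg r)
      have : (Finset.univ.erase i).card ≤ n := (Finset.card_le_univ _).trans (by simp)
      exact_mod_cast this
  rw [← Finset.add_sum_erase _ _ (Finset.mem_univ i),
    ← Finset.add_sum_erase _ (fun j => ‖T j i‖ ^ 2) (Finset.mem_univ i), hTi] at h1
  obtain ⟨p1, p2⟩ := hbd (fun j => ‖T j i‖) a fun j hj => by rw [abs_norm]; exact hT j hj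
  obtain ⟨q1, q2⟩ := hbd (fun j => ‖(Vᴴ * T) j i‖) b fun j hj => by rw [abs_norm]; exact hW j hj
  have h2 : |‖(Vᴴ * T) i i‖ ^ 2 - 1| ≤ n * (a ^ 2 + b ^ 2) := by
    rw [norm_one, one_pow] at h1
    rw [abs_le]
    constructor <;> nlinarith
  -- For x ≥ 0, |x - 1| ≤ |x - 1|(x + 1) = |x² - 1|.
  refine le_trans ?_ h2
  have h3 : ‖(Vᴴ * T) i i‖ ^ 2 - 1 = (‖(Vᴴ * T) i i‖ - 1) * (‖(Vᴴ * T) i i‖ + 1) := by ring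
  rw [h3, abs_mul]
  refine le_mul_of_one_le_right (abs_nonneg _) ?_
  rw [abs_of_nonneg (by positivity)]
  linarith [norm_nonneg ((Vᴴ * T) i i)]

/-- Taking p_i to be the phase of the i-th diagonal overlap makes the diagonal of (VP)^*T real and
positive. Since VP is unitary, ‖VP - T‖ = ‖I - (VP)^*T‖, which is bounded entrywise. -/
theorem exists_phases_norm_sub_le (hV : V ∈ Matrix.unitaryGroup (Fin n) ℂ) {r : ℝ}
    (hd : ∀ i, (Vᴴ * T) i i ≠ 0) (hdiag : ∀ i, |‖(Vᴴ * T) i i‖ - 1| ≤ r)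
    (hoff : ∀ k i, k ≠ i → ‖(Vᴴ * T) k i‖ ≤ r) :
    ∃ p : Fin n → ℂ, (∀ i, ‖p i‖ = 1) ∧ ‖V * Matrix.diagonal p - T‖ ≤ n * (n * r) := by
  let p : Fin n → ℂ := fun i => (Vᴴ * T) i i / ‖(Vᴴ * T) i i‖
  have hp : ∀ i, ‖p i‖ = 1 := fun i => by
    simp only [p, norm_div, Complex.norm_real, norm_norm]
    exact div_self (norm_ne_zero_iff.2 (hd i))
  refine ⟨p, hp, ?_⟩
  have hV' : V * Matrix.diagonal p ∈ Matrix.unitaryGroup (Fin n) ℂ :=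
    mul_mem hV (diagonal_mem_unitaryGroup hp)
  have h1 : V * Matrix.diagonal p - T
      = (V * Matrix.diagonal p) * (1 - (V * Matrix.diagonal p)ᴴ * T) := by
    rw [Matrix.mul_sub, Matrix.mul_one, ← Matrix.mul_assoc, ← Matrix.star_eq_conjTranspose,
      Matrix.mem_unitaryGroup_iff.1 hV', Matrix.one_mul]
  rw [h1, CStarRing.norm_mem_unitary_mul _ hV']
  refine l2_opNorm_le_of_entry_le fun k i => ?_
  have h2 : ((V * Matrix.diagonal p)ᴴ * T) k i = star (p k) * (Vᴴ * T) k i := by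
    rw [Matrix.conjTranspose_mul, Matrix.diagonal_conjTranspose, Matrix.mul_assoc,
      Matrix.diagonal_mul, Pi.star_apply]
  rw [Matrix.sub_apply, h2]
  by_cases hki : k = i
  · subst hki
    have h3 : star (p k) * (Vᴴ * T) k k = (‖(Vᴴ * T) k k‖ : ℂ) := by
      have h4 : (‖(Vᴴ * T) k k‖ : ℂ) ≠ 0 := by simpa using hd k
      rw [← starRingEnd_apply]
      simp only [p]
      rw [map_div₀, Complex.conj_ofReal, div_mul_eq_mul_div, Complex.conj_mul']
      field_simp
    rw [h3, Matrix.one_apply_eq, ← Complex.ofReal_one, ← Complex.ofReal_sub, Complex.norm_real,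
      Real.norm_eq_abs, abs_sub_comm]
    exact hdiag k
  · rw [Matrix.one_apply_ne hki, zero_sub, norm_neg, norm_mul, norm_star, hp, one_mul]
    exact hoff k i hki

end Eigenbasis

/-! ### Matching eigenvalues and bounding off-diagonal overlaps -/

section Perturbation

variable {n : ℕ} {α : Fin n → ℝ} {F V T : Matrix (Fin n) (Fin n) ℂ} {ξ : Fin n → ℝ} {β : Fin n → ℂ}

/-- The columns of `T` are the block solutions `(e_i, -N⁻¹ C^* e_i)` of the Schur complements. -/
theorem exists_schur_columns (hF : F.IsHermitian) {s : ℝ}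
    (hdet : ∀ i, IsUnit ((Lam α - (α i : ℂ) • (1 : Matrix (Fin n) (Fin n) ℂ) + F).toBlock
      (fun j => α j ≠ α i) (fun j => α j ≠ α i)).det)
    (hB : ∀ ρ ∈ Set.range α, ∃ B : Matrix {i // α i = ρ} {i // α i = ρ} ℂ,
      IsSchurComplement α F ρ B ∧ B.IsDiag ∧ ∀ i j, i ≠ j → s ≤ ‖B i i - B j j‖) :
    ∃ (T : Matrix (Fin n) (Fin n) ℂ) (β : Fin n → ℂ),
      (∀ i j, α j = α i → T j i = if j = i then 1 else 0) ∧
      (∀ i j, ((α j : ℂ) - α i) * T j i + (F * T) j i = if j = i then β i else 0) ∧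
      ∀ i j, i ≠ j → α i = α j → s ≤ ‖β i - β j‖ := by
  choose! B hB1 hB2 hB3 using hB
  have hcol : ∀ i, ∃ v : Fin n → ℂ, (∀ j, α j = α i → v j = if j = i then 1 else 0) ∧
      ∀ j, ((α j : ℂ) - α i) * v j + (F *ᵥ v) j
        = if j = i then B (α i) ⟨i, rfl⟩ ⟨i, rfl⟩ else 0 := fun i =>
    exists_schur_column hF (hB1 _ ⟨i, rfl⟩) (hB2 _ ⟨i, rfl⟩) (hdet i) ⟨i, rfl⟩
  choose v hv1 hv2 using hcol
  refine ⟨Matrix.of fun j i => v i j, fun i => B (α i) ⟨i, rfl⟩ ⟨i, rfl⟩, fun i j => hv1 i j,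
    fun i j => hv2 i j, fun i j hij hα => ?_⟩
  have hβ : ∀ ρ (h : α j = ρ), B (α j) ⟨j, rfl⟩ ⟨j, rfl⟩ = B ρ ⟨j, h⟩ ⟨j, h⟩ := by
    rintro _ rfl; rfl
  simp only [hβ (α i) hα.symm]
  exact hB3 (α i) ⟨i, rfl⟩ _ _ fun h => hij (congrArg Subtype.val h)

/-- The columns of an eigenbasis can be ordered so that the eigenvalues match the approximate
ones. -/
theorem exists_matched_diagonalization {g ε η : ℝ} (hg : 0 < g) (hη : 0 < η)
    (hηn : ∀ W : Matrix (Fin n) (Fin n) ℂ, (∀ i j, ‖W i j‖ ≤ n) → 1 / 2 ≤ ‖W.det‖ →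
      ∃ σ : Equiv.Perm (Fin n), ∀ i, η ≤ ‖W (σ i) i‖)
    (hF : F.IsHermitian)
    (hT1 : ∀ i j, α j = α i → T j i = if j = i then 1 else 0)
    (hT2 : ∀ i j, ((α j : ℂ) - α i) * T j i + (F * T) j i = if j = i then β i else 0)
    (hT3 : ∀ i j, α j ≠ α i → ‖T j i‖ ≤ 2 * ε / g) (hβ : ∀ i, ‖β i‖ ≤ 2 * ε)
    (hT : ∀ i j, ‖T i j‖ ≤ 1) (hdet : 1 / 2 ≤ ‖T.det‖) :
    ∃ V ∈ Matrix.unitaryGroup (Fin n) ℂ, ∃ ξ : Fin n → ℝ,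
      (Lam α + F) * V = V * Matrix.diagonal (fun i => (ξ i : ℂ)) ∧
      ∀ i, η ≤ ‖(Vᴴ * T) i i‖ ∧ ‖(ξ i : ℂ) - (α i + β i)‖ ≤ 4 * n / (g * η) * ε ^ 2 := by
  obtain ⟨V, hV, ξ, hVξ⟩ := exists_unitary_diagonalization ((isHermitian_Lam α).add hF)
  have hV1 : ∀ k j, ‖Vᴴ k j‖ ≤ 1 := fun k j => by
    rw [Matrix.conjTranspose_apply, norm_star]
    exact entry_norm_bound_of_unitary hV j k
  -- Unitarity of V gives |det(V^*T)| = |det T| ≥ 1/2. Dividing the overlap identity by an overlap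
  -- of size at least η then bounds the eigenvalue error.
  obtain ⟨σ, hσ⟩ := hηn (Vᴴ * T) (fun i j => by
      rw [Matrix.mul_apply]
      refine (norm_sum_mul_le (hV1 i) fun k => hT k j).trans ?_
      rw [one_mul, mul_one]) (by
      have h : ‖V.det‖ = 1 := by
        have h1 : V.det ∈ unitary ℂ := Matrix.det_of_mem_unitary hV
        exact CStarRing.norm_of_mem_unitary h1
      rw [Matrix.det_mul, Matrix.det_conjTranspose, norm_mul, norm_star, h, one_mul]
      exact hdet)
  have hVσ : (Lam α + F) * V.submatrix id σ
      = V.submatrix id σ * Matrix.diagonal fun i => (ξ (σ i) : ℂ) := by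
    ext j k
    have h := congrFun (congrFun hVξ j) (σ k)
    rw [Matrix.mul_diagonal] at h ⊢
    exact h
  refine ⟨_, submatrix_perm_mem_unitaryGroup hV σ, fun i => ξ (σ i), hVσ, fun i => ⟨hσ i, ?_⟩⟩
  have h := overlap_eq hF hVξ hT1 hT2 (σ i) i
  have hε : 0 ≤ ε := by linarith [(norm_nonneg _).trans (hβ i)]
  have h1 : ‖∑ j, Vᴴ (σ i) j * (if α j = α i then 0 else T j i)‖ ≤ n * (1 * (2 * ε / g)) := by
    refine norm_sum_mul_le (hV1 _) fun j => ?_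
    split_ifs with hj
    · rw [norm_zero]; positivity
    · exact hT3 i j hj
  have h2 : ‖(ξ (σ i) : ℂ) - (α i + β i)‖ * η ≤ 2 * ε * (n * (1 * (2 * ε / g))) := by
    calc _ ≤ ‖(ξ (σ i) : ℂ) - (α i + β i)‖ * ‖(Vᴴ * T) (σ i) i‖ :=
          mul_le_mul_of_nonneg_left (hσ i) (norm_nonneg _)
      _ = ‖β i‖ * ‖∑ j, Vᴴ (σ i) j * (if α j = α i then 0 else T j i)‖ := by
          rw [← norm_mul, h, norm_mul, norm_neg]
      _ ≤ _ := mul_le_mul (hβ i) h1 (norm_nonneg _) (by positivity)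
  rw [← le_div_iff₀ hη] at h2
  refine h2.trans (le_of_eq ?_)
  field_simp
  ring

/-- The overlap identity is divided by the eigenvalue separation. The term 8n/g² of the constant
serves indices in different blocks (separation g/2), and 16n/(g²c) indices in the same block
(separation cε/2). -/
theorem norm_overlap_le {g ε c K : ℝ} (hg0 : 0 < g) (hc : 0 < c) (hε0 : 0 < ε)
    (hg : ∀ i j, α i ≠ α j → g ≤ |α i - α j|) (hF : F.IsHermitian) (hFε : ‖F‖ ≤ ε)
    (hT1 : ∀ i j, α j = α i → T j i = if j = i then 1 else 0)
    (hT2 : ∀ i j, ((α j : ℂ) - α i) * T j i + (F * T) j i = if j = i then β i else 0)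
    (hT3 : ∀ i j, α j ≠ α i → ‖T j i‖ ≤ 2 * ε / g) (hβ : ∀ i, ‖β i‖ ≤ 2 * ε)
    (hβc : ∀ i j, i ≠ j → α i = α j → c * ε ≤ ‖β i - β j‖)
    (hV : V ∈ Matrix.unitaryGroup (Fin n) ℂ)
    (hVξ : (Lam α + F) * V = V * Matrix.diagonal fun i => (ξ i : ℂ))
    (hξ : ∀ i, ‖(ξ i : ℂ) - (α i + β i)‖ ≤ K * ε ^ 2)
    (hε1 : K * ε ≤ c / 2) (hε2 : 4 * ε + K * ε ^ 2 ≤ g / 2) {k i : Fin n} (hki : k ≠ i) :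
    ‖(Vᴴ * T) k i‖ ≤ (8 * n / g ^ 2 + 16 * n / (g ^ 2 * c)) * ε ^ 2 := by
  have h := overlap_eq hF hVξ hT1 hT2 k i
  have key : ∀ {a b : ℝ}, 0 < a → a ≤ ‖(ξ k : ℂ) - (α i + β i)‖ →
      (∀ j, α j ≠ α i → ‖V j k‖ ≤ b) → 0 ≤ b →
      ‖(Vᴴ * T) k i‖ ≤ 2 * ε * (n * (b * (2 * ε / g))) / a := by
    intro a b ha hab hVb hb
    have h1 : ‖∑ j, Vᴴ k j * (if α j = α i then 0 else T j i)‖ ≤ n * (b * (2 * ε / g)) := by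
      have : ∑ j, Vᴴ k j * (if α j = α i then 0 else T j i)
          = ∑ j, (if α j = α i then 0 else Vᴴ k j) * (if α j = α i then 0 else T j i) :=
        Finset.sum_congr rfl fun j _ => by split_ifs <;> simp
      rw [this]
      refine norm_sum_mul_le (fun j => ?_) fun j => ?_ <;> split_ifs with hj
      · rwa [norm_zero]
      · rw [Matrix.conjTranspose_apply, norm_star]; exact hVb j hj
      · rw [norm_zero]; positivity
      · exact hT3 i j hj
    rw [le_div_iff₀ ha, mul_comm]
    calc _ ≤ ‖(ξ k : ℂ) - (α i + β i)‖ * ‖(Vᴴ * T) k i‖ :=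
          mul_le_mul_of_nonneg_right hab (norm_nonneg _)
      _ = ‖β i‖ * ‖∑ j, Vᴴ k j * (if α j = α i then 0 else T j i)‖ := by
          rw [← norm_mul, h, norm_mul, norm_neg]
      _ ≤ _ := mul_le_mul (hβ i) h1 (norm_nonneg _) (by positivity)
  have hnorm : ∀ i j, ‖(α i : ℂ) - α j‖ = |α i - α j| := fun i j => by
    rw [← Complex.ofReal_sub, Complex.norm_real, Real.norm_eq_abs]
  by_cases hα : α k = α i
  · have hab : c * ε / 2 ≤ ‖(ξ k : ℂ) - (α i + β i)‖ := by
      have h1 := norm_sub_norm_le (β k - β i) (-((ξ k : ℂ) - (α k + β k)))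
      have h2 : β k - β i - -((ξ k : ℂ) - (α k + β k)) = (ξ k : ℂ) - (α i + β i) := by
        rw [hα]; ring
      rw [h2, norm_neg] at h1
      have h3 : K * ε ^ 2 ≤ c / 2 * ε := by
        rw [pow_two, ← mul_assoc]; exact mul_le_mul_of_nonneg_right hε1 hε0.le
      linarith [hβc k i hki hα, hξ k]
    -- The extra factor ε that pays for the small separation: ξ_k is far from α_j, so the
    -- eigenvector equation makes V_jk of order ε.
    have hVb : ∀ j, α j ≠ α i → ‖V j k‖ ≤ 2 * ε / g := by
      intro j hj
      have h1 := congrArg norm (eigenvector_entry hVξ j k)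
      rw [norm_mul, norm_neg] at h1
      have h2 : ‖(F * V) j k‖ ≤ ε := by
        refine (entry_le_l2_opNorm _ _ _).trans ?_
        rwa [CStarRing.norm_mul_mem_unitary _ hV]
      have h3 : g / 2 ≤ ‖(α j : ℂ) - ξ k‖ := by
        have h4 := norm_sub_norm_le ((α j : ℂ) - α k) (((ξ k : ℂ) - (α k + β k)) + β k)
        have h5 : (α j : ℂ) - α k - (((ξ k : ℂ) - (α k + β k)) + β k) = α j - ξ k := by ring
        rw [h5, hnorm] at h4
        have h6 := norm_add_le ((ξ k : ℂ) - (α k + β k)) (β k)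
        linarith [hg j k (hα ▸ hj), hβ k, hξ k]
      rw [le_div_iff₀ hg0]
      nlinarith [norm_nonneg (V j k)]
    refine (key (by positivity) hab hVb (by positivity)).trans ?_
    calc 2 * ε * (n * (2 * ε / g * (2 * ε / g))) / (c * ε / 2)
        = 16 * n / (g ^ 2 * c) * ε ^ 2 := by field_simp; ring
      _ ≤ _ := by
        refine mul_le_mul_of_nonneg_right ?_ (sq_nonneg ε)
        have : 0 ≤ 8 * n / g ^ 2 := by positivity
        linarith
  · have hab : g / 2 ≤ ‖(ξ k : ℂ) - (α i + β i)‖ := by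
      have h4 := norm_sub_norm_le ((α k : ℂ) - α i) (β i - β k - ((ξ k : ℂ) - (α k + β k)))
      have h5 : (α k : ℂ) - α i - (β i - β k - ((ξ k : ℂ) - (α k + β k)))
          = ξ k - (α i + β i) := by ring
      rw [h5, hnorm] at h4
      have h6 := norm_sub_le (β i - β k) ((ξ k : ℂ) - (α k + β k))
      have h7 := norm_sub_le (β i) (β k)
      linarith [hg k i hα, hβ k, hβ i, hξ k]
    refine (key (by positivity) hab (fun j _ => entry_norm_bound_of_unitary hV j k)
      zero_le_one).trans ?_
    calc 2 * ε * (n * (1 * (2 * ε / g))) / (g / 2)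
        = 8 * n / g ^ 2 * ε ^ 2 := by field_simp; ring
      _ ≤ _ := by
        refine mul_le_mul_of_nonneg_right ?_ (sq_nonneg ε)
        have : 0 ≤ 16 * n / (g ^ 2 * c) := by positivity
        linarith

end Perturbation

/-! ### The estimate for small perturbations of Λ -/

section FirstOrder

variable {n : ℕ}

open Topology in
theorem exists_eigenbasis_near_first_order (α : Fin n → ℝ) {c : ℝ} (hc : 0 < c) :
    ∃ δ > 0, ∃ K : ℝ, ∀ F : Matrix (Fin n) (Fin n) ℂ, F.IsHermitian → ‖F‖ < δ →
      (∀ ρ ∈ Set.range α, ∃ B : Matrix {i // α i = ρ} {i // α i = ρ} ℂ,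
        IsSchurComplement α F ρ B ∧ B.IsDiag ∧ ∀ i j, i ≠ j → c * ‖F‖ ≤ ‖B i i - B j j‖) →
      ∃ V ∈ Matrix.unitaryGroup (Fin n) ℂ, ∃ ξ : Fin n → ℝ,
        (Lam α + F) * V = V * Matrix.diagonal (fun i => (ξ i : ℂ)) ∧
        ‖V - (1 - Matrix.hadamard (matM α) F)‖ ≤ K * ‖F‖ ^ 2 := by
  obtain ⟨g, hg0, hg1, hg⟩ := exists_gap α
  obtain ⟨d, hd0, hd⟩ := exists_half_le_norm_det n
  obtain ⟨η, hη0, hη⟩ := exists_perm_norm_entry_ge n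
  -- K₁ governs the eigenvalue error, K₂ the off-diagonal overlaps, and K₃ both these and the
  -- diagonal defect.
  set K₁ : ℝ := 4 * n / (g * η)
  set K₂ : ℝ := 8 * n / g ^ 2 + 16 * n / (g ^ 2 * c)
  have hK₂ : 0 ≤ K₂ := by positivity
  set K₃ : ℝ := n * ((2 / g) ^ 2 + K₂ ^ 2) + K₂
  have ev : ∀ {f : ℝ → ℝ} {b : ℝ}, Continuous f → f 0 < b → ∀ᶠ ε in 𝓝 (0 : ℝ), f ε < b :=
    fun hf hb => hf.continuousAt.eventually_lt continuousAt_const hb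
  -- All smallness conditions are strict and continuous, and hold at ε = 0.
  have hev : ∀ᶠ ε in 𝓝 (0 : ℝ), (n + 1) * ε < g ∧ 2 * n * ε < g ∧ 2 * ε / g < 1 ∧
      n * (n * (2 * ε / g)) < d ∧ K₁ * ε < c / 2 ∧ 4 * ε + K₁ * ε ^ 2 < g / 2 ∧ ε < 1 := by
    refine (ev (by fun_prop) (by simpa)).and <| (ev (by fun_prop) (by simpa)).and <|
      (ev (by fun_prop) (by simp)).and <| (ev (by fun_prop) (by simpa)).and <|
      (ev (by fun_prop) (by simpa)).and <| (ev (by fun_prop) (by simpa)).and <|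
      (ev (by fun_prop) (by simp))
  obtain ⟨δ, hδ0, hδ⟩ := Metric.eventually_nhds_iff.1 hev
  refine ⟨δ, hδ0, n * (n * K₃) + n * (n * (2 * n / g ^ 2)), fun F hF hFδ hB => ?_⟩
  -- At F = 0 the required separation c‖F‖ vanishes and gives no control, but the identity is an
  -- exact eigenbasis.
  rcases (norm_nonneg F).eq_or_lt with h0 | hε0
  · have hF0 : F = 0 := norm_eq_zero.1 h0.symm
    subst hF0
    exact ⟨1, one_mem _, α, by simp [Lam], by simp⟩
  have hbd := hδ (y := ‖F‖) (by simpa using hFδ)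
  have hFε := entry_le_l2_opNorm F
  set ε := ‖F‖ with hε
  obtain ⟨e1, e2, e3, e4, e5, e6, e7⟩ := hbd
  obtain ⟨T, β, hT1, hT2, hβc⟩ := exists_schur_columns hF
    (isUnit_det_toBlock_ne hg hFε e1) hB
  have hcol := fun i => schur_column_bounds hg0 (fun j => hg j i) hFε e2.le (rfl : α i = α i)
    (hT1 i) (hT2 i)
  have hβ := fun i => (hcol i).1
  have hT3 : ∀ i j, α j ≠ α i → ‖T j i‖ ≤ 2 * ε / g := fun i => (hcol i).2.1
  have hTii : ∀ i, T i i = 1 := fun i => by simp [hT1 i i rfl]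
  have ha0 : 0 ≤ 2 * ε / g := by positivity
  have hToff : ∀ i j, j ≠ i → ‖T j i‖ ≤ 2 * ε / g := fun i j hji => by
    by_cases h : α j = α i
    · rwa [hT1 i j h, if_neg hji, norm_zero]
    · exact hT3 i j h
  have hTone : ∀ i j, ‖T i j‖ ≤ 1 := fun i j => by
    by_cases h : i = j
    · rw [h, hTii, norm_one]
    · exact (hToff j i h).trans e3.le
  have hdet : 1 / 2 ≤ ‖T.det‖ := by
    refine hd T (lt_of_le_of_lt (l2_opNorm_le_of_entry_le fun i j => ?_) e4)
    by_cases h : i = j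
    · rwa [h, Matrix.sub_apply, hTii, Matrix.one_apply_eq, sub_self, norm_zero]
    · rw [Matrix.sub_apply, Matrix.one_apply_ne h, sub_zero]
      exact hToff j i h
  obtain ⟨V, hV, ξ, hVξ, hm⟩ :=
    exists_matched_diagonalization hg0 hη0 hη hF hT1 hT2 hT3 hβ hTone hdet
  have hW : ∀ k i, k ≠ i → ‖(Vᴴ * T) k i‖ ≤ K₂ * ε ^ 2 := fun k i hki =>
    norm_overlap_le hg0 hc hε0 hg hF le_rfl hT1 hT2 hT3 hβ hβc hV hVξ (fun i => (hm i).2)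
      e5.le e6.le hki
  obtain ⟨p, hp, hpT⟩ := exists_phases_norm_sub_le hV (T := T) (r := K₃ * ε ^ 2)
    (fun i => norm_pos_iff.1 (hη0.trans_le (hm i).1))
    (fun i => by
      refine (abs_norm_overlap_sub_one_le hV (hTii i) (fun j => hToff i j)
        fun k => hW k i).trans ?_
      have h1 : ε ^ 2 ≤ 1 := pow_le_one₀ hε0.le e7.le
      have h2 : (K₂ * ε ^ 2) ^ 2 ≤ K₂ ^ 2 * ε ^ 2 := by
        rw [mul_pow]
        refine mul_le_mul_of_nonneg_left ?_ (sq_nonneg _)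
        exact pow_le_of_le_one (sq_nonneg ε) h1 two_ne_zero
      calc n * ((2 * ε / g) ^ 2 + (K₂ * ε ^ 2) ^ 2)
          ≤ n * ((2 * ε / g) ^ 2 + K₂ ^ 2 * ε ^ 2) := by gcongr
        _ = n * ((2 / g) ^ 2 + K₂ ^ 2) * ε ^ 2 := by ring
        _ ≤ K₃ * ε ^ 2 := mul_le_mul_of_nonneg_right (le_add_of_nonneg_right hK₂) (sq_nonneg ε))
    (fun k i hki => (hW k i hki).trans <| by
      refine mul_le_mul_of_nonneg_right ?_ (sq_nonneg ε)
      exact le_add_of_nonneg_left (by positivity))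
  refine ⟨V * Matrix.diagonal p, mul_mem hV (diagonal_mem_unitaryGroup hp), ξ, ?_, ?_⟩
  · rw [← Matrix.mul_assoc, hVξ, Matrix.mul_assoc, Matrix.mul_assoc, Matrix.diagonal_mul_diagonal,
      Matrix.diagonal_mul_diagonal]
    simp only [mul_comm]
  · have hTM : ‖T - (1 - Matrix.hadamard (matM α) F)‖ ≤ n * (n * (2 * n * ε ^ 2 / g ^ 2)) := by
      refine l2_opNorm_le_of_entry_le fun j i => ?_
      rw [Matrix.sub_apply, Matrix.sub_apply, Matrix.hadamard_apply]
      by_cases h : α j = α i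
      · have : matM α j i = 0 := by simp [matM, h]
        rw [this, hT1 i j h, Matrix.one_apply, zero_mul, sub_zero, sub_self, norm_zero]
        positivity
      · have hji : j ≠ i := fun h' => h (h' ▸ rfl)
        have h1 : matM α j i = 1 / ((α j : ℂ) - α i) := by simp [matM, h]
        rw [h1, Matrix.one_apply_ne hji]
        convert (hcol i).2.2 j h using 2
        ring
    refine (norm_sub_le_norm_sub_add_norm_sub _ T _).trans ((add_le_add hpT hTM).trans ?_)
    exact le_of_eq (by ring)

end FirstOrder

/-! ### All of V_c, and the return to the original basis -/

theorem proposition5p1 {n : ℕ} (A UA : Matrix (Fin n) (Fin n) ℂ) (α : Fin n → ℝ)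
    (hUA : UA ∈ Matrix.unitaryGroup (Fin n) ℂ) (hA : A = UA * Lam α * UAᴴ)
    (c : ℝ) (hc : 0 < c) :
    ∃ U : VSet α UA c → Matrix.unitaryGroup (Fin n) ℂ,
      (∀ E : VSet α UA c, ∀ j : Fin n, ∃ ξ : ℝ,
        Module.End.HasEigenvector (Matrix.toLin' (A + (E : Matrix (Fin n) (Fin n) ℂ))) (ξ : ℂ)
          ((U E : Matrix (Fin n) (Fin n) ℂ).col j)) ∧
      ∃ K : ℝ, ∀ E : VSet α UA c,
        ‖(U E : Matrix (Fin n) (Fin n) ℂ) - Uap α UA E‖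
          ≤ K * ‖hat UA (E : Matrix (Fin n) (Fin n) ℂ)‖ ^ 2 := by
  obtain ⟨δ, hδ0, K, hK⟩ := exists_eigenbasis_near_first_order α hc
  have hUA1 : UAᴴ * UA = 1 := Matrix.mem_unitaryGroup_iff'.1 hUA
  have hUA2 : UA * UAᴴ = 1 := Matrix.mem_unitaryGroup_iff.1 hUA
  let m : ℝ := n * (n * ‖fun p : Fin n × Fin n => matM α p.1 p.2‖)
  have hM : ∀ F : Matrix (Fin n) (Fin n) ℂ, ‖Matrix.hadamard (matM α) F‖ ≤ m * ‖F‖ := by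
    intro F
    refine (l2_opNorm_le_of_entry_le (r := ‖fun p : Fin n × Fin n => matM α p.1 p.2‖ * ‖F‖)
      fun i j => ?_).trans (le_of_eq ?_)
    · rw [Matrix.hadamard_apply, norm_mul]
      exact mul_le_mul (norm_le_pi_norm (fun p : Fin n × Fin n => matM α p.1 p.2) (i, j))
        (entry_le_l2_opNorm F i j) (norm_nonneg _) (norm_nonneg _)
    · simp only [m]; ring
  have hm0 : 0 ≤ m := by positivity
  have hone : ∀ V ∈ Matrix.unitaryGroup (Fin n) ℂ, ‖V‖ ≤ 1 := fun V hV => by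
    have h := Matrix.l2_opNorm_diagonal (1 : Fin n → ℂ)
    rw [← mul_one V, CStarRing.norm_mem_unitary_mul _ hV, ← Matrix.diagonal_one]
    exact h.le.trans (pi_norm_le_iff_of_nonneg zero_le_one |>.2 fun i => by simp)
  have key : ∀ E : VSet α UA c, ∃ V ∈ Matrix.unitaryGroup (Fin n) ℂ, ∃ ξ : Fin n → ℝ,
      (Lam α + hat UA E) * V = V * Matrix.diagonal (fun i => (ξ i : ℂ)) ∧
      ‖V - (1 - Matrix.hadamard (matM α) (hat UA E))‖
        -- The second entry handles ‖Ê‖ ≥ δ: the difference is at most 2 + m‖Ê‖, and ‖Ê‖/δ ≥ 1 lets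
        -- this be absorbed into ‖Ê‖².
        ≤ max K (2 / δ ^ 2 + m / δ) * ‖hat UA E‖ ^ 2 := by
    rintro ⟨E, hEh, hE⟩
    have hF : (hat UA E).IsHermitian := Matrix.isHermitian_conjTranspose_mul_mul UA hEh
    have hn : ‖hat UA E‖ = ‖E‖ := by
      rw [hat, CStarRing.norm_mul_mem_unitary _ hUA]
      exact CStarRing.norm_mem_unitary_mul _ (Unitary.star_mem hUA)
    rcases lt_or_ge ‖hat UA E‖ δ with hlt | hge
    · obtain ⟨V, hV, ξ, h1, h2⟩ := hK (hat UA E) hF hlt (by rwa [hn])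
      exact ⟨V, hV, ξ, h1, h2.trans (mul_le_mul_of_nonneg_right (le_max_left _ _) (sq_nonneg _))⟩
    · obtain ⟨V, hV, ξ, h1⟩ := exists_unitary_diagonalization ((isHermitian_Lam α).add hF)
      refine ⟨V, hV, ξ, h1, ?_⟩
      have h2 := norm_sub_le V (1 - Matrix.hadamard (matM α) (hat UA E))
      have h3 := norm_sub_le (1 : Matrix (Fin n) (Fin n) ℂ) (Matrix.hadamard (matM α) (hat UA E))
      have h4 : 2 + m * ‖hat UA E‖ ≤ (2 / δ ^ 2 + m / δ) * ‖hat UA E‖ ^ 2 := by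
        set x := ‖hat UA E‖
        have hx : 1 ≤ x / δ := (one_le_div hδ0).2 hge
        have h5 : (2 / δ ^ 2 + m / δ) * x ^ 2 = 2 * (x / δ) ^ 2 + m * x * (x / δ) := by ring
        rw [h5]
        have h6 : 1 ≤ (x / δ) ^ 2 := one_le_pow₀ hx
        have h7 : m * x ≤ m * x * (x / δ) :=
          le_mul_of_one_le_right (mul_nonneg hm0 (norm_nonneg _)) hx
        linarith
      have h8 := mul_le_mul_of_nonneg_right (le_max_right K (2 / δ ^ 2 + m / δ))
        (sq_nonneg ‖hat UA E‖)
      linarith [hone V hV, hone 1 (one_mem _), hM (hat UA E)]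
  choose V hV ξ hVξ hVn using key
  refine ⟨fun E => ⟨UA * V E, mul_mem hUA (hV E)⟩, fun E j => ⟨ξ E j, ?_⟩,
    max K (2 / δ ^ 2 + m / δ), fun E => ?_⟩
  · have hAE : A + (E : Matrix (Fin n) (Fin n) ℂ) = UA * (Lam α + hat UA E) * UAᴴ := by
      have : UA * (UAᴴ * (E : Matrix (Fin n) (Fin n) ℂ) * UA) * UAᴴ
          = (UA * UAᴴ) * E * (UA * UAᴴ) := by simp only [Matrix.mul_assoc]
      rw [hA, hat, Matrix.mul_add, Matrix.add_mul, this, hUA2, Matrix.one_mul, Matrix.mul_one]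
    have hU : (A + (E : Matrix (Fin n) (Fin n) ℂ)) * (UA * V E)
        = (UA * V E) * Matrix.diagonal fun i => (ξ E i : ℂ) := by
      rw [hAE, Matrix.mul_assoc _ UAᴴ, ← Matrix.mul_assoc UAᴴ, hUA1, Matrix.one_mul,
        Matrix.mul_assoc, hVξ, Matrix.mul_assoc]
    rw [Module.End.hasEigenvector_iff, Module.End.mem_eigenspace_iff]
    constructor
    · rw [Matrix.toLin'_apply]
      funext i
      have h := congrFun (congrFun hU i) j
      rw [Matrix.mul_diagonal] at h
      rw [Pi.smul_apply, smul_eq_mul, mul_comm]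
      exact h
    · intro h0
      have h1 := congrFun (congrFun (Matrix.mem_unitaryGroup_iff'.1 (mul_mem hUA (hV E))) j) j
      rw [Matrix.one_apply_eq, Matrix.mul_apply] at h1
      have h2 : ∀ i, (UA * V E) i j = 0 := fun i => congrFun h0 i
      simp [h2] at h1
  · change ‖UA * V E - Uap α UA E‖ ≤ _
    rw [Uap, ← Matrix.mul_sub, CStarRing.norm_mem_unitary_mul _ hUA]
    exact hVn E
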